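/- A net $N=(P,T,F)$ consists of disjoint non-empty sets $P$ of places and $T$ of transitions and a flow relation $F\subseteq (P\times T)\cup(T\times P)$ whose graph is weakly connected. Write ${}^\bullet x$ and $x^\bullet$ for the sets of input and output nodes of a node $x$. $N$ is proper if ${}^\bullet t\neq\emptyset\neq t^\bullet$ for every $t\in T$, and free-choice if any two transitions $t_1,t_2$ satisfy ${}^\bullet t_1={}^\bullet t_2$ or ${}^\bullet t_1\cap{}^\bullet t_2=\emptyset$. A marking is a multiset of places. A transition $t$ is enabled in $M$ if every place of ${}^\bullet t$ is marked; firing it removes one token from each place of ${}^\bullet t$ and adds one token to each place of $t^\bullet$. $(N,M)$ is live if from every reachable marking and for every transition $t$ one can reach a marking that enables $t$; it is bounded if some $k$ bounds the number of tokens in every place in every reachable marking. The cluster of a node $x$ is the smallest set of nodes that contains $x$, contains $p^\bullet$ for each place $p$ in it, and contains ${}^\bullet t$ for each transition $t$ in it. A cluster $C$ is a home cluster of $(N,M)$ if the marking with exactly one token in each place of $C$ is reachable from every marking reachable from $M$. For a marking $M$ with at most one token in each place, let $\mathrm{conn}(N,M)$ be the set of nodes on directed paths that start in a place marked in $M$,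 and let $\mathrm{clean}(N,M)$ be the restriction of $N$ to the nodes in $\mathrm{conn}(N,M)$. For a cluster $C\subseteq \mathrm{conn}(N,M)$, let $N_{C,M}$ be $\mathrm{clean}(N,M)$ with one fresh transition $t_C$ added, where ${}^\bullet t_C=C\cap P$ and $t_C^\bullet=\{p\in P\mid M(p)\ge 1\}$, and let $\hat C=C\cup\{t_C\}$. Theorem. Let $N$ be a proper free-choice net, $M$ a marking of $N$ with at most one token in each place, and $C\subseteq\mathrm{conn}(N,M)$ a cluster of $N$. Consider the statements (1) $C$ is a home cluster of $(N,M)$; (2) $\hat C$ is a home cluster of $(N_{C,M},M)$; (3) $(N_{C,M},M)$ is live and bounded; and the condition (K) every input place of every transition in $\mathrm{conn}(N,M)$ belongs to $\mathrm{conn}(N,M)$ (that is, cleaning takes no input place away from a transition that it keeps). If (K) holds, then (1), (2) and (3) are equivalent. Moreover, (1) always implies (K), and (2) and (3) are equivalent whether or not (K) holds. (So (1) is always equivalent to (2) together with (K), and to (3) together with (K).) -/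

import Mathlib

/-- The data `(P, T, F)` of a net. Places and transitions are two types, hence disjoint; the flow
relation is split into its arcs from places to transitions and from transitions to places. -/
structure Net (P T : Type*) where
  /-- there is an arc from the place `p` to the transition `t` -/
  arcPT : P → T → Prop
  /-- there is an arc from the transition `t` to the place `p` -/
  arcTP : T → P → Prop

/-- A marking is a multiset of places, given by its multiplicities. -/
abbrev Marking (P : Type*) := P → ℕ

/-- The marking with exactly one token in each place of `S`. -/
noncomputable def Marking.ofSet {P : Type*} (S : Set P) : Marking P := S.indicator 1

namespace Net

variable {P T : Type*}

/-- The flow relation `F` on the set `P ∪ T` of nodes. -/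
def Flow (N : Net P T) : P ⊕ T → P ⊕ T → Prop
  | Sum.inl p, Sum.inr t => N.arcPT p t
  | Sum.inr t, Sum.inl p => N.arcTP t p
  | _, _ => False

/-- The input places of a transition. -/
def pre (N : Net P T) (t : T) : Set P := {p | N.arcPT p t}

/-- The output places of a transition. -/
def post (N : Net P T) (t : T) : Set P := {p | N.arcTP t p}

/-- A Petri net has a place and a transition, and its graph is weakly connected. -/
def IsPetriNet (N : Net P T) : Prop :=
  Nonempty P ∧ Nonempty T ∧
    ∀ x y : P ⊕ T, Relation.ReflTransGen (fun a b => N.Flow a b ∨ N.Flow b a) x y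

/-- Every transition has an input place and an output place. -/
def IsProper (N : Net P T) : Prop :=
  ∀ t : T, (N.pre t).Nonempty ∧ (N.post t).Nonempty

def IsFreeChoice (N : Net P T) : Prop :=
  ∀ t₁ t₂ : T, N.pre t₁ = N.pre t₂ ∨ N.pre t₁ ∩ N.pre t₂ = ∅

/-! ### Behaviour -/

/-- `t` is enabled in `M`. -/
def Enabled (N : Net P T) (M : Marking P) (t : T) : Prop :=
  ∀ p ∈ N.pre t, 1 ≤ M p

/-- The marking that results from firing `t` in `M` (used for enabled `t` only). -/
noncomputable def fire (N : Net P T) (M : Marking P) (t : T) : Marking P :=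
  fun p => M p - Marking.ofSet (N.pre t) p + Marking.ofSet (N.post t) p

/-- `N.Fires M σ M'`: the sequence `σ` can be fired in `M` and leads to `M'`. -/
inductive Fires (N : Net P T) : Marking P → List T → Marking P → Prop
  | nil (M : Marking P) : Fires N M [] M
  | cons {M M' : Marking P} {t : T} {σ : List T} :
      N.Enabled M t → Fires N (N.fire M t) σ M' → Fires N M (t :: σ) M'

/-- The set of markings reachable from `M`. -/
def reach (N : Net P T) (M : Marking P) : Set (Marking P) :=
  {M' | ∃ σ : List T, N.Fires M σ M'}

def IsLive (N : Net P T) (M : Marking P) : Prop :=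
  ∀ M' ∈ N.reach M, ∀ t : T, ∃ M'' ∈ N.reach M', N.Enabled M'' t

def IsBounded (N : Net P T) (M : Marking P) : Prop :=
  ∃ k : ℕ, ∀ M' ∈ N.reach M, ∀ p : P, M' p ≤ k

def IsHomeMarking (N : Net P T) (M MH : Marking P) : Prop :=
  ∀ M' ∈ N.reach M, MH ∈ N.reach M'

/-! ### Clusters -/

/-- The cluster of the node `x`: the smallest set of nodes containing `x`, containing with a place
all its output transitions, and containing with a transition all its input places. -/
inductive cluster (N : Net P T) (x : P ⊕ T) : Set (P ⊕ T)
  | self : cluster N x x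
  | place {p : P} {t : T} :
      cluster N x (Sum.inl p) → N.arcPT p t → cluster N x (Sum.inr t)
  | transition {p : P} {t : T} :
      cluster N x (Sum.inr t) → N.arcPT p t → cluster N x (Sum.inl p)

def IsCluster (N : Net P T) (C : Set (P ⊕ T)) : Prop :=
  ∃ x : P ⊕ T, C = N.cluster x

end Net

/-- The places of a set of nodes. -/
def Pl {P T : Type*} (C : Set (P ⊕ T)) : Set P := {p | Sum.inl p ∈ C}

/-- One token in each place of `C`. -/
noncomputable def Mrk {P T : Type*} (C : Set (P ⊕ T)) : Marking P := Marking.ofSet (Pl C)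

namespace Net

variable {P T : Type*}

def IsHomeCluster (N : Net P T) (M : Marking P) (C : Set (P ⊕ T)) : Prop :=
  N.IsCluster C ∧ N.IsHomeMarking M (Mrk C)

/-! ### Cleaning and short-circuiting -/

/-- The nodes on directed paths that start in a marked place. -/
def conn (N : Net P T) (M : Marking P) : Set (P ⊕ T) :=
  {x | ∃ p : P, 1 ≤ M p ∧ Relation.ReflTransGen N.Flow (Sum.inl p) x}

/-- The places of the cleaned net. -/
abbrev CleanP (N : Net P T) (M : Marking P) := {p : P // Sum.inl p ∈ N.conn M}

/-- The transitions of the cleaned net. -/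
abbrev CleanT (N : Net P T) (M : Marking P) := {t : T // Sum.inr t ∈ N.conn M}

/-- The cleaned net: the restriction of the net to the nodes in `conn`. -/
def clean (N : Net P T) (M : Marking P) : Net (N.CleanP M) (N.CleanT M) where
  arcPT p t := N.arcPT p.1 t.1
  arcTP t p := N.arcTP t.1 p.1

/-- The short-circuited net. The fresh transition is `none`; its input places are the places of
`C`, its output places are the places marked in `M`. -/
def shortCirc (N : Net P T) (C : Set (P ⊕ T)) (M : Marking P) : Net P (Option T) where
  arcPT p t? := match t? with
    | some t => N.arcPT p t
    | none => p ∈ Pl C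
  arcTP t? p := match t? with
    | some t => N.arcTP t p
    | none => 1 ≤ M p

/-- The marking `M` on the places of the cleaned net (no other place is marked in `M`). -/
def cleanMarking (N : Net P T) (M : Marking P) : Marking (N.CleanP M) := fun p => M p.1

/-- The nodes of `C` that belong to the cleaned net. -/
def cleanNodes (N : Net P T) (M : Marking P) (C : Set (P ⊕ T)) :
    Set (N.CleanP M ⊕ N.CleanT M) :=
  {x | Sum.map Subtype.val Subtype.val x ∈ C}

/-- The short-circuited cleaned net `N_{C,M}`. -/
def cleanShortCirc (N : Net P T) (C : Set (P ⊕ T)) (M : Marking P) :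
    Net (N.CleanP M) (Option (N.CleanT M)) :=
  (N.clean M).shortCirc (N.cleanNodes M C) (N.cleanMarking M)

/-- The extended cluster: `C` together with the fresh transition. -/
def hatCluster (N : Net P T) (M : Marking P) (C : Set (P ⊕ T)) :
    Set (N.CleanP M ⊕ Option (N.CleanT M)) :=
  Sum.map id some '' N.cleanNodes M C ∪ {Sum.inr none}

/-- Cleaning takes no input place away from a transition that it keeps. -/
def ConnInputClosed (N : Net P T) (M : Marking P) : Prop :=
  ∀ t : T, Sum.inr t ∈ N.conn M → ∀ p ∈ N.pre t, Sum.inl p ∈ N.conn M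

end Net

/-! The core concerns a set `S` of places such that each transition has preset `S` or takes nothing
from `S`, and whose one-token marking is a home marking. By `IsHomeMarking.not_fires_add`, extra
tokens can never be got rid of, so a reachable marking that covers `ofSet S` equals it
(`IsHomeMarking.eq_of_le`). Two consequences follow. Every node of `conn` can be marked or enabled
(`conn_live`), because a token must move unless it already lies in `S`, and free choice lets the
mover be chosen. Every reachable marking is safe (`le_one`), because two tokens could be driven
along one shortest path until `S` is covered with a token to spare.

Applied to the short-circuited net, this gives (2) ⇒ (3): from the home marking, `t_C` restores `M`.
For (3) ⇒ (2), a surplus left when `t_C` becomes enabled could be accumulated without bound. Under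
(K) the cleaned net and `N` enable the same transitions of `conn`, and by `eq_of_le` the transition
`t_C` only fires at the exact home marking, where it restarts from `M`; hence (1) ⇔ (2). Finally (1)
gives (K), since each transition of `conn` gets enabled and tokens never leave `conn`. -/

namespace Marking

variable {P : Type*}

theorem ofSet_apply_of_mem {S : Set P} {p : P} (h : p ∈ S) : ofSet S p = 1 := by
  simp [ofSet, h]

theorem ofSet_apply_of_notMem {S : Set P} {p : P} (h : p ∉ S) : ofSet S p = 0 := by
  simp [ofSet, h]

theorem one_le_ofSet {S : Set P} {p : P} : 1 ≤ ofSet S p ↔ p ∈ S := by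
  by_cases h : p ∈ S <;> simp [ofSet, h]

theorem ofSet_le_one (S : Set P) (p : P) : ofSet S p ≤ 1 := by
  by_cases h : p ∈ S <;> simp [ofSet, h]

theorem ofSet_le {S : Set P} {M : Marking P} : ofSet S ≤ M ↔ ∀ p ∈ S, 1 ≤ M p := by
  constructor
  · intro h p hp
    exact (one_le_ofSet.2 hp).trans (h p)
  · intro h p
    by_cases hp : p ∈ S
    · rw [ofSet_apply_of_mem hp]; exact h p hp
    · rw [ofSet_apply_of_notMem hp]; exact Nat.zero_le _

theorem ofSet_one_le {M : Marking P} (h : ∀ p, M p ≤ 1) : ofSet {p | 1 ≤ M p} = M := by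
  funext p
  by_cases hp : p ∈ {p | 1 ≤ M p}
  · rw [ofSet_apply_of_mem hp]; exact le_antisymm hp (h p)
  · rw [ofSet_apply_of_notMem hp]; exact (Nat.lt_one_iff.1 (not_le.1 hp)).symm

theorem exists_one_le_of_ne_zero {M : Marking P} (h : M ≠ 0) : ∃ p, 1 ≤ M p := by
  by_contra! hc
  exact h (funext fun p => Nat.lt_one_iff.1 (hc p))

end Marking

namespace Net

open Marking

variable {P T : Type*} {N : Net P T}

/-! ### Enabling and firing a single transition -/

theorem fire_apply (M : Marking P) (t : T) (p : P) :
    N.fire M t p = M p - ofSet (N.pre t) p + ofSet (N.post t) p := rfl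

theorem enabled_iff {M : Marking P} {t : T} : N.Enabled M t ↔ ofSet (N.pre t) ≤ M :=
  ofSet_le.symm

theorem le_fire_of_notMem_pre {t : T} {p : P} (M : Marking P) (h : p ∉ N.pre t) :
    M p ≤ N.fire M t p := by
  rw [fire_apply, ofSet_apply_of_notMem h]; omega

theorem one_le_fire_of_mem_post {t : T} {p : P} (M : Marking P) (h : p ∈ N.post t) :
    1 ≤ N.fire M t p := by
  rw [fire_apply, ofSet_apply_of_mem h]; omega

theorem IsFreeChoice.pre_eq (hfc : N.IsFreeChoice) {s t : T} {p : P} (hs : p ∈ N.pre s)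
    (ht : p ∈ N.pre t) : N.pre s = N.pre t :=
  (hfc s t).resolve_right fun h => (h ▸ ⟨hs, ht⟩ : p ∈ (∅ : Set P))

theorem Enabled.congr_pre {M : Marking P} {s t : T} (h : N.Enabled M s)
    (hst : N.pre s = N.pre t) : N.Enabled M t := fun p hp => h p (hst ▸ hp)

theorem Enabled.mono {M M' : Marking P} {t : T} (h : N.Enabled M t) (hM : M ≤ M') :
    N.Enabled M' t := fun p hp => (h p hp).trans (hM p)

theorem fire_add {M : Marking P} {t : T} (h : N.Enabled M t) (X : Marking P) :
    N.fire (M + X) t = N.fire M t + X := by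
  funext p
  have : ofSet (N.pre t) p ≤ M p := enabled_iff.1 h p
  simp only [fire_apply, Pi.add_apply]
  omega

/-! ### Firing sequences -/

theorem Fires.append {M M' M'' : Marking P} {σ τ : List T} (h : N.Fires M σ M')
    (h' : N.Fires M' τ M'') : N.Fires M (σ ++ τ) M'' := by
  induction h with
  | nil _ => exact h'
  | cons he _ ih => exact .cons he (ih h')

theorem Fires.eq_or_enabled {M M' : Marking P} {σ : List T} (h : N.Fires M σ M') :
    M = M' ∨ ∃ t, N.Enabled M t := by
  cases h with
  | nil => exact .inl rfl
  | cons he _ => exact .inr ⟨_, he⟩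

theorem Fires.add {M M' : Marking P} {σ : List T} (h : N.Fires M σ M') (X : Marking P) :
    N.Fires (M + X) σ (M' + X) := by
  induction h with
  | nil _ => exact .nil _
  | cons he _ ih =>
    refine .cons (he.mono le_self_add) ?_
    rwa [fire_add he]

theorem mem_reach_self (M : Marking P) : M ∈ N.reach M := ⟨[], .nil M⟩

theorem reach_trans {M M' M'' : Marking P} (h : M' ∈ N.reach M) (h' : M'' ∈ N.reach M') :
    M'' ∈ N.reach M := by
  obtain ⟨σ, hσ⟩ := h
  obtain ⟨τ, hτ⟩ := h'
  exact ⟨σ ++ τ, hσ.append hτ⟩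

theorem fire_mem_reach {M : Marking P} {t : T} (h : N.Enabled M t) : N.fire M t ∈ N.reach M :=
  ⟨[t], .cons h (.nil _)⟩

theorem reach_induction {M : Marking P} {Q : Marking P → Prop} (h0 : Q M)
    (hstep : ∀ L t, Q L → N.Enabled L t → Q (N.fire L t)) {M' : Marking P}
    (h : M' ∈ N.reach M) : Q M' := by
  obtain ⟨σ, hσ⟩ := h
  induction hσ with
  | nil _ => exact h0
  | cons he _ ih => exact ih (hstep _ _ h0 he)

theorem IsHomeMarking.of_reach {M MH M' : Marking P} (h : N.IsHomeMarking M MH)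
    (h' : M' ∈ N.reach M) : N.IsHomeMarking M' MH :=
  fun L hL => h L (reach_trans h' hL)

/-- A proper net cannot lose its last token. -/
theorem Fires.ne_zero (hproper : N.IsProper) {M M' : Marking P} {σ : List T}
    (h : N.Fires M σ M') (hM : M ≠ 0) : M' ≠ 0 := by
  induction h with
  | nil _ => exact hM
  | @cons M _ t _ _ _ ih =>
    refine ih fun h0 => ?_
    obtain ⟨p, hp⟩ := (hproper t).2
    have := one_le_fire_of_mem_post M hp
    simp [h0] at this

/-- An enabled transition may be fired ahead of transitions with other input places. -/
theorem Fires.bring_forward {v : T} {τ : List T} {M' : Marking P} :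
    ∀ {σ : List T} {M : Marking P}, N.Fires M (σ ++ v :: τ) M' → N.Enabled M v →
      (∀ s ∈ σ, N.pre s ∩ N.pre v = ∅) → N.Fires (N.fire M v) (σ ++ τ) M'
  | [], _, h, _, _ => by cases h with | cons _ h => exact h
  | s :: σ, M, h, hv, hσ => by
    cases h with
    | cons hs h =>
      have hd : ∀ p, p ∈ N.pre s → p ∉ N.pre v := fun p hp hp' =>
        (hσ s (by simp) ▸ ⟨hp, hp'⟩ : p ∈ (∅ : Set P))
      have hv' : N.Enabled (N.fire M s) v := fun p hp =>
        (hv p hp).trans (le_fire_of_notMem_pre M fun hp' => hd p hp' hp)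
      have ih := Fires.bring_forward h hv' fun s' hs' => hσ s' (by simp [hs'])
      refine .cons (fun p hp => (hs p hp).trans (le_fire_of_notMem_pre M (hd p hp))) ?_
      -- Subtraction is truncated, so commutation relies on both transitions being enabled in `M`.
      have hcomm : N.fire (N.fire M v) s = N.fire (N.fire M s) v := by
        funext p
        have h1 : ofSet (N.pre s) p ≤ M p := enabled_iff.1 hs p
        have h2 : ofSet (N.pre v) p ≤ M p := enabled_iff.1 hv p
        simp only [fire_apply]
        by_cases hp : p ∈ N.pre s
        · rw [ofSet_apply_of_notMem (hd p hp)] at *; omega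
        · rw [ofSet_apply_of_notMem hp] at *; omega
      rwa [hcomm]

/-- Tokens that no transition of the sequence consumes can be removed. -/
theorem Fires.sub_idle {A : Set P} {L : Marking P} :
    ∀ {σ : List T} {X : Marking P}, N.Fires (ofSet A + X) σ L →
      (∀ s ∈ σ, N.pre s ∩ A = ∅) → ∃ Y, L = ofSet A + Y ∧ N.Fires X σ Y
  | [], X, h, _ => by cases h; exact ⟨X, rfl, .nil _⟩
  | s :: σ, X, h, hσ => by
    cases h with
    | cons hs h =>
      have hd : ∀ p, p ∈ N.pre s → p ∉ A := fun p hp hp' =>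
        (hσ s (by simp) ▸ ⟨hp, hp'⟩ : p ∈ (∅ : Set P))
      have hs' : N.Enabled X s := fun p hp => by
        have := hs p hp
        rwa [Pi.add_apply, ofSet_apply_of_notMem (hd p hp), zero_add] at this
      rw [add_comm, fire_add hs', add_comm] at h
      obtain ⟨Y, hY, hf⟩ := Fires.sub_idle h fun s' hs' => hσ s' (by simp [hs'])
      exact ⟨Y, hY, .cons hs' hf⟩

/-- Either no token is ever removed from `B`, or some reachable marking that has still all the
tokens in `B` enables a transition that removes one. -/
theorem Fires.stay_or_enabled (B : Set P) {M M' : Marking P} {σ : List T} (h : N.Fires M σ M') :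
    (∀ p ∈ B, M p ≤ M' p) ∨
      ∃ L ∈ N.reach M, ∃ v, N.Enabled L v ∧ (∃ p ∈ B, p ∈ N.pre v) ∧ ∀ p ∈ B, M p ≤ L p := by
  induction h with
  | nil M => exact .inl fun p _ => le_rfl
  | @cons M M' t σ he _ ih =>
    by_cases ht : ∃ p ∈ B, p ∈ N.pre t
    · exact .inr ⟨M, mem_reach_self M, t, he, ht, fun p _ => le_rfl⟩
    · push Not at ht
      have hle : ∀ p ∈ B, M p ≤ N.fire M t p := fun p hp => le_fire_of_notMem_pre M (ht p hp)
      rcases ih with ih | ⟨L, hL, v, hv, hB, hLB⟩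
      · exact .inl fun p hp => (hle p hp).trans (ih p hp)
      · exact .inr ⟨L, reach_trans (fire_mem_reach he) hL, v, hv, hB,
          fun p hp => (hle p hp).trans (hLB p hp)⟩

/-! ### Home markings of clusters

The results of this section are about a set `S` of places such that every transition has `S` as
its set of input places or takes no token from `S`; the places of a cluster form such a set. -/

section Home

variable {S : Set P}

theorem pre_eq_of_mem (hS : ∀ t, N.pre t = S ∨ N.pre t ∩ S = ∅) {t : T} {p : P}
    (hp : p ∈ N.pre t) (hpS : p ∈ S) : N.pre t = S :=
  (hS t).resolve_right fun h => (h ▸ ⟨hp, hpS⟩ : p ∈ (∅ : Set P))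

/-- If `ofSet S` is a home marking for `M`, it is not reachable from `M` plus additional tokens. -/
theorem IsHomeMarking.not_fires_add (hproper : N.IsProper) (hfc : N.IsFreeChoice)
    (hS : ∀ t, N.pre t = S ∨ N.pre t ∩ S = ∅) {X : Marking P} (hX : X ≠ 0) :
    ∀ (n : ℕ) {σ : List T} {M : Marking P}, σ.length = n → N.IsHomeMarking M (ofSet S) →
      ¬ N.Fires (M + X) σ (ofSet S) := by
  intro n
  induction n using Nat.strong_induction_on with
  | _ n ih =>
    intro σ M hn hM hf
    -- If `M` alone enables a preset used in `σ`, the first such transition of `σ` can be fired at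
    -- once from `M` and from `M + X`, which shortens `σ`.
    by_cases hu : ∃ u, N.Enabled M u ∧ ∃ s ∈ σ, N.pre s = N.pre u
    · obtain ⟨u, hu, hs⟩ := hu
      classical
      obtain ⟨v, hv⟩ : ∃ v, σ.find? (fun s => N.pre s = N.pre u) = some v := by
        rw [← Option.isSome_iff_exists, List.find?_isSome]
        simpa using hs
      obtain ⟨hvu, σ₁, σ₂, rfl, hσ₁⟩ := List.find?_eq_some_iff_append.1 hv
      have hvu : N.pre v = N.pre u := by simpa using hvu
      have hvM : N.Enabled M v := hu.congr_pre hvu.symm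
      have hf' := hf.bring_forward (hvM.mono le_self_add) fun s hs =>
        (hfc s v).resolve_left fun h => by simpa [h, hvu] using hσ₁ s hs
      rw [fire_add hvM] at hf'
      refine ih _ ?_ rfl (hM.of_reach (fire_mem_reach hvM)) hf'
      simp only [List.length_append, List.length_cons] at hn ⊢
      omega
    · push Not at hu
      -- Otherwise, if `M` enables `u`, then `σ` leaves the tokens on the preset of `u` in place.
      -- They survive into `ofSet S`, so this preset meets `S` and equals it.
      have hle : ofSet S ≤ M := by
        obtain ⟨ρ, hρ⟩ := hM M (mem_reach_self M)
        rcases hρ.eq_or_enabled with rfl | ⟨u, he⟩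
        · exact le_rfl
        · have hM' : ofSet (N.pre u) + (M - ofSet (N.pre u) + X) = M + X := by
            rw [← add_assoc, add_tsub_cancel_of_le (enabled_iff.1 he)]
          rw [← hM'] at hf
          obtain ⟨Y, hY, -⟩ := hf.sub_idle fun s hs => (hfc s u).resolve_left (hu u he s hs)
          obtain ⟨p, hp⟩ := (hproper u).1
          have hpS : p ∈ S := by
            rw [← one_le_ofSet, hY, Pi.add_apply, ofSet_apply_of_mem hp]
            omega
          exact pre_eq_of_mem hS hp hpS ▸ enabled_iff.1 he
      -- Now `σ` takes nothing from `S`, so it would have to carry the nonzero rest to the empty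
      -- marking, impossible in a proper net.
      have hM' : ofSet S + (M - ofSet S + X) = M + X := by
        rw [← add_assoc, add_tsub_cancel_of_le hle]
      rw [← hM'] at hf
      obtain ⟨Y, hY, hf'⟩ := hf.sub_idle fun s hs => (hS s).resolve_left fun h =>
        hu s (enabled_iff.2 (h ▸ hle)) s hs rfl
      refine hf'.ne_zero hproper (fun h => hX ?_) (left_eq_add.1 hY)
      exact (add_eq_zero.1 h).2

/-- Since `ofSet S` is a home marking for itself, a proper surplus over it would contradict
`not_fires_add`. -/
theorem IsHomeMarking.eq_of_le (hproper : N.IsProper) (hfc : N.IsFreeChoice)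
    (hS : ∀ t, N.pre t = S ∨ N.pre t ∩ S = ∅) {M M' : Marking P}
    (hM : N.IsHomeMarking M (ofSet S)) (hM' : M' ∈ N.reach M) (hle : ofSet S ≤ M') :
    M' = ofSet S := by
  by_contra hne
  have hX : M' - ofSet S ≠ 0 := fun h => hne (le_antisymm (tsub_eq_zero_iff_le.1 h) hle)
  obtain ⟨σ, hσ⟩ := hM M' hM'
  rw [← add_tsub_cancel_of_le hle] at hσ
  exact IsHomeMarking.not_fires_add hproper hfc hS hX _ rfl
    (hM.of_reach (hM M (mem_reach_self M))) hσ

/-- From a marking with a token in `p` one can enable every output transition of `p`. -/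
theorem IsHomeMarking.exists_enabled (hfc : N.IsFreeChoice)
    (hS : ∀ t, N.pre t = S ∨ N.pre t ∩ S = ∅) {M : Marking P}
    (hM : N.IsHomeMarking M (ofSet S)) {p : P} (hp : 1 ≤ M p) {t : T} (ht : p ∈ N.pre t) :
    ∃ M' ∈ N.reach M, N.Enabled M' t := by
  obtain ⟨σ, hσ⟩ := hM M (mem_reach_self M)
  rcases hσ.stay_or_enabled {p} with h | ⟨L, hL, v, hv, ⟨q, rfl, hq⟩, -⟩
  · have hpS : p ∈ S := one_le_ofSet.1 (hp.trans (h p rfl))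
    exact ⟨ofSet S, ⟨σ, hσ⟩, enabled_iff.2 (pre_eq_of_mem hS ht hpS ▸ le_rfl)⟩
  · exact ⟨L, hL, hv.congr_pre (hfc.pre_eq hq ht)⟩

/-- Every place of `conn` can be marked and every transition of `conn` can be enabled. -/
theorem IsHomeMarking.conn_live (hfc : N.IsFreeChoice)
    (hS : ∀ t, N.pre t = S ∨ N.pre t ∩ S = ∅) {M : Marking P}
    (hM : N.IsHomeMarking M (ofSet S)) {x : P ⊕ T} (hx : x ∈ N.conn M) :
    ∃ L ∈ N.reach M, Sum.elim (fun p => 1 ≤ L p) (N.Enabled L) x := by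
  obtain ⟨p, hp, hpx⟩ := hx
  induction hpx with
  | refl => exact ⟨M, mem_reach_self M, hp⟩
  | @tail y z _ hyz ih =>
    obtain ⟨L, hL, hy⟩ := ih
    match y, z, hyz with
    | .inl q, .inr t, hqt =>
      obtain ⟨L', hL', ht⟩ := (hM.of_reach hL).exists_enabled hfc hS hy hqt
      exact ⟨L', reach_trans hL hL', ht⟩
    | .inr t, .inl q, htq =>
      exact ⟨_, reach_trans hL (fire_mem_reach hy), one_le_fire_of_mem_post L htq⟩

/-! ### Safeness -/

/-- The places from which a path with `n` transitions leads into `S`. -/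
def layer (N : Net P T) (S : Set P) : ℕ → Set P
  | 0 => S
  | n + 1 => {p | ∃ t, p ∈ N.pre t ∧ ∃ q ∈ N.post t, q ∈ N.layer S n}

/-- The distance from a place to `S`. -/
noncomputable def dist (N : Net P T) (S : Set P) (p : P) : ℕ := sInf {n | p ∈ N.layer S n}

/-- By free choice, input places of a common transition have the same output transitions, hence the
same paths to `S`. -/
theorem mem_layer_of_mem_pre (hfc : N.IsFreeChoice) (hS : ∀ t, N.pre t = S ∨ N.pre t ∩ S = ∅)
    {t : T} {p q : P} (hp : p ∈ N.pre t) (hq : q ∈ N.pre t) :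
    ∀ {n : ℕ}, p ∈ N.layer S n → q ∈ N.layer S n
  | 0, h => pre_eq_of_mem hS hp h ▸ hq
  | _ + 1, ⟨s, hs, h⟩ => ⟨s, hfc.pre_eq hp hs ▸ hq, h⟩

theorem dist_eq_of_mem_pre (hfc : N.IsFreeChoice) (hS : ∀ t, N.pre t = S ∨ N.pre t ∩ S = ∅)
    {t : T} {p q : P} (hp : p ∈ N.pre t) (hq : q ∈ N.pre t) : N.dist S p = N.dist S q := by
  have : {n | p ∈ N.layer S n} = {n | q ∈ N.layer S n} :=
    Set.ext fun n => ⟨mem_layer_of_mem_pre hfc hS hp hq, mem_layer_of_mem_pre hfc hS hq hp⟩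
  rw [dist, dist, this]

theorem dist_eq_zero_of_mem {p : P} (hp : p ∈ S) : N.dist S p = 0 :=
  Nat.eq_zero_of_le_zero (Nat.sInf_le (show p ∈ N.layer S 0 from hp))

/-- A shortest path to `S`, indexed by the distance to `S`. -/
theorem exists_shortest_path :
    ∀ {n : ℕ} {p : P}, p ∈ N.layer S n → N.dist S p = n →
      ∃ f : ℕ → P, f n = p ∧ f 0 ∈ S ∧ (∀ i ≤ n, N.dist S (f i) = i) ∧
        ∀ i < n, ∃ t, f (i + 1) ∈ N.pre t ∧ f i ∈ N.post t
  | 0, p, hp, hd => ⟨fun _ => p, rfl, hp, fun i hi => by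
      obtain rfl := Nat.le_zero.1 hi
      exact hd, fun i hi => absurd hi (Nat.not_lt_zero i)⟩
  | n + 1, p, ⟨t, hpt, q, hqt, hq⟩, hd => by
    have hdq : N.dist S q = n := by
      refine le_antisymm (Nat.sInf_le hq) ?_
      have hmem : q ∈ N.layer S (N.dist S q) := Nat.sInf_mem (s := {n | q ∈ N.layer S n}) ⟨n, hq⟩
      have : N.dist S p ≤ N.dist S q + 1 := Nat.sInf_le ⟨t, hpt, q, hqt, hmem⟩
      omega
    obtain ⟨f, hfn, hf0, hfd, hft⟩ := exists_shortest_path hq hdq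
    refine ⟨Function.update f (n + 1) p, by simp, by simpa using hf0, fun i hi => ?_,
      fun i hi => ?_⟩
    · rcases hi.eq_or_lt with rfl | hi
      · simpa using hd
      · rw [Function.update_of_ne hi.ne]
        exact hfd i (by omega)
    · rw [Function.update_of_ne hi.ne]
      rcases (Nat.lt_succ_iff.1 hi).eq_or_lt with rfl | hi'
      · exact ⟨t, by simpa using hpt, hfn ▸ hqt⟩
      · rw [Function.update_of_ne (by omega)]
        exact hft i hi'

/-- A marked place has a path to `S`. -/
theorem exists_mem_layer (hproper : N.IsProper) {M : Marking P} (h : ofSet S ∈ N.reach M) {p : P}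
    (hp : 1 ≤ M p) : ∃ n, p ∈ N.layer S n := by
  by_contra! hc
  -- Invariant: some token lies on a place without a path to `S`. If it is consumed, any output
  -- place of the consuming transition also has no such path.
  obtain ⟨q, hq, hqS⟩ := reach_induction (Q := fun L => ∃ q, 1 ≤ L q ∧ ∀ n, q ∉ N.layer S n)
    ⟨p, hp, hc⟩ (fun L t ⟨q, hq, hqn⟩ _ => by
      by_cases hqt : q ∈ N.pre t
      · obtain ⟨r, hr⟩ := (hproper t).2
        exact ⟨r, one_le_fire_of_mem_post L hr, fun n hn => hqn (n + 1) ⟨t, hqt, r, hr, hn⟩⟩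
      · exact ⟨q, hq.trans (le_fire_of_notMem_pre L hqt), hqn⟩) h
  exact hqS 0 (one_le_ofSet.1 hq)

/-- There are never two tokens on a shortest path to `S`. -/
theorem IsHomeMarking.not_two_tokens (hproper : N.IsProper) (hfc : N.IsFreeChoice)
    (hS : ∀ t, N.pre t = S ∨ N.pre t ∩ S = ∅) {f : ℕ → P} {n : ℕ} (hf0 : f 0 ∈ S)
    (hfd : ∀ i ≤ n, N.dist S (f i) = i)
    (hft : ∀ i < n, ∃ t, f (i + 1) ∈ N.pre t ∧ f i ∈ N.post t) :
    ∀ (m : ℕ) {i k : ℕ} {L : Marking P}, i + k = m → i ≤ n → k ≤ n →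
      N.IsHomeMarking L (ofSet S) → 1 ≤ L (f i) → 1 ≤ L (f k) → (i = k → 2 ≤ L (f i)) → False := by
  -- In `ofSet S` both tokens are at distance 0, hence on the same place, which holds only one.
  have hend : ∀ {i k : ℕ}, i ≤ n → k ≤ n → 1 ≤ ofSet S (f i) → 1 ≤ ofSet S (f k) →
      (i = k → 2 ≤ ofSet S (f i)) → False := by
    intro i k hi hk h1 h2 h3
    have hi0 := dist_eq_zero_of_mem (N := N) (one_le_ofSet.1 h1)
    have hk0 := dist_eq_zero_of_mem (N := N) (one_le_ofSet.1 h2)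
    rw [hfd _ hi] at hi0
    rw [hfd _ hk] at hk0
    have := h3 (hi0.trans hk0.symm)
    have := ofSet_le_one S (f i)
    omega
  intro m
  induction m using Nat.strong_induction_on with
  | _ m ih =>
    -- Once some `v` can consume the token on `f i`, free choice also enables the path's own
    -- transition, which brings the token one step closer and lowers `i + k`.
    have hadv : ∀ {i k : ℕ} {L : Marking P} {v : T}, i + k = m → i ≤ n → k ≤ n →
        N.IsHomeMarking L (ofSet S) → 1 ≤ L (f i) → 1 ≤ L (f k) → (i = k → 2 ≤ L (f i)) →
        N.Enabled L v → f i ∈ N.pre v → False := by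
      intro i k L v hm hi hk hL h1 h2 h3 hv hiv
      match i with
      | 0 =>
        have hle : ofSet S ≤ L := pre_eq_of_mem hS hiv hf0 ▸ enabled_iff.1 hv
        obtain rfl := hL.eq_of_le hproper hfc hS (mem_reach_self L) hle
        exact hend hi hk h1 h2 h3
      | i + 1 =>
        obtain ⟨t, hit, hti⟩ := hft i hi
        have ht := hv.congr_pre (hfc.pre_eq hiv hit)
        -- Inputs of one transition have equal distance to `S`, whereas distinct indices on the path
        -- have distinct distances; so the other token is untouched.
        have hkt : i + 1 ≠ k → f k ∉ N.pre t := fun hne hkt => hne <| by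
          rw [← hfd _ hi, ← hfd _ hk]
          exact dist_eq_of_mem_pre hfc hS hit hkt
        refine ih (i + k) (by omega) rfl (by omega) hk (hL.of_reach (fire_mem_reach ht))
          (one_le_fire_of_mem_post L hti) ?_ ?_
        · by_cases hik : i + 1 = k
          · have := h3 hik
            have := ofSet_le_one (N.pre t) (f k)
            subst hik
            rw [fire_apply]
            omega
          · exact h2.trans (le_fire_of_notMem_pre L (hkt hik))
        · rintro rfl
          rw [fire_apply, ofSet_apply_of_mem hti, ofSet_apply_of_notMem (hkt (by omega))]
          omega
    intro i k L hm hi hk hL h1 h2 h3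
    obtain ⟨σ, hσ⟩ := hL L (mem_reach_self L)
    -- Run towards the home marking until one of the two places is about to lose a token.
    rcases hσ.stay_or_enabled {f i, f k} with h | ⟨L', hL', v, hv, ⟨p, hp, hpv⟩, h⟩
    · exact hend hi hk (h1.trans (h _ (by simp))) (h2.trans (h _ (by simp)))
        fun hik => (h3 hik).trans (h _ (by simp))
    · have h1' := h1.trans (h (f i) (by simp))
      have h2' := h2.trans (h (f k) (by simp))
      have h3' := fun hik => (h3 hik).trans (h (f i) (by simp))
      rcases hp with rfl | rfl
      · exact hadv hm hi hk (hL.of_reach hL') h1' h2' h3' hv hpv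
      · refine hadv (by omega) hk hi (hL.of_reach hL') h2' h1' (fun hik => ?_) hv hpv
        subst hik
        exact h3' rfl

theorem IsHomeMarking.le_one (hproper : N.IsProper) (hfc : N.IsFreeChoice)
    (hS : ∀ t, N.pre t = S ∨ N.pre t ∩ S = ∅) {M M' : Marking P}
    (hM : N.IsHomeMarking M (ofSet S)) (hM' : M' ∈ N.reach M) (p : P) : M' p ≤ 1 := by
  by_contra! hp
  have hex := exists_mem_layer hproper (hM M' hM') (p := p) (by omega)
  obtain ⟨f, hfn, hf0, hfd, hft⟩ := exists_shortest_path
    (Nat.sInf_mem (s := {n | p ∈ N.layer S n}) hex) rfl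
  rw [← hfn] at hp
  exact IsHomeMarking.not_two_tokens hproper hfc hS hf0 hfd hft _ rfl le_rfl le_rfl
    (hM.of_reach hM') (by omega) (by omega) fun _ => hp

end Home

end Net

namespace Net

open Marking

variable {P T : Type*} {N : Net P T} {M : Marking P} {C : Set (P ⊕ T)}

/-! ### Clusters of free-choice nets -/

theorem IsCluster.mem_transition (hC : N.IsCluster C) {p : P} {t : T} (hp : p ∈ Pl C)
    (hpt : p ∈ N.pre t) : Sum.inr t ∈ C := by
  obtain ⟨x, rfl⟩ := hC
  exact .place hp hpt

theorem IsCluster.pre_subset (hC : N.IsCluster C) {t : T} (ht : Sum.inr t ∈ C) :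
    N.pre t ⊆ Pl C := by
  obtain ⟨x, rfl⟩ := hC
  exact fun p hp => .transition ht hp

theorem IsCluster.nonempty (hC : N.IsCluster C) : C.Nonempty := by
  obtain ⟨x, rfl⟩ := hC
  exact ⟨x, .self⟩

/-- The property `K` below, being an input of `t` or having the preset of `t`, passes both ways
along each place-to-transition arc, so it spreads from `t` to its whole cluster. -/
theorem IsCluster.pre_eq (hfc : N.IsFreeChoice) (hC : N.IsCluster C) {t : T}
    (ht : Sum.inr t ∈ C) : N.pre t = Pl C := by
  refine (hC.pre_subset ht).antisymm ?_
  obtain ⟨x, rfl⟩ := hC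
  let K : P ⊕ T → Prop := Sum.elim (· ∈ N.pre t) (fun s => N.pre s = N.pre t)
  have harc : ∀ {p s}, N.arcPT p s → (K (.inl p) ↔ K (.inr s)) := fun {p s} hps =>
    ⟨fun hp => hfc.pre_eq hps hp, fun hs => (hs : N.pre s = N.pre t).subset hps⟩
  have hK : ∀ y ∈ N.cluster x, (K y ↔ K x) := by
    intro y hy
    induction hy with
    | self => exact Iff.rfl
    | place _ hpt ih => exact (harc hpt).symm.trans ih
    | transition _ hpt ih => exact (harc hpt).trans ih
  have hx : K x := (hK _ ht).1 rfl
  exact fun p hp => (hK _ hp).2 hx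

theorem IsCluster.pre_eq_or (hfc : N.IsFreeChoice) (hC : N.IsCluster C)
    (t : T) : N.pre t = Pl C ∨ N.pre t ∩ Pl C = ∅ := by
  rcases (N.pre t ∩ Pl C).eq_empty_or_nonempty with h | ⟨p, hpt, hpC⟩
  · exact .inr h
  · exact .inl (hC.pre_eq hfc (hC.mem_transition hpC hpt))

theorem IsCluster.nonempty_places (hproper : N.IsProper) (hC : N.IsCluster C) :
    (Pl C).Nonempty := by
  obtain ⟨x | t, hx⟩ := hC.nonempty
  · exact ⟨x, hx⟩
  · exact (hproper t).1.mono (hC.pre_subset hx)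

/-! ### The short-circuited cleaned net -/

theorem conn_flow {x y : P ⊕ T} (hx : x ∈ N.conn M) (h : N.Flow x y) : y ∈ N.conn M := by
  obtain ⟨p, hp, hpx⟩ := hx
  exact ⟨p, hp, hpx.tail h⟩

theorem exists_pre_mem_conn {t : T} (ht : Sum.inr t ∈ N.conn M) :
    ∃ p ∈ N.pre t, Sum.inl p ∈ N.conn M := by
  obtain ⟨p, hp, hpt⟩ := ht
  rcases hpt.cases_tail with h | ⟨y, hy, hyt⟩
  · cases h
  · match y, hyt with
    | .inl q, hqt => exact ⟨q, hqt, p, hp, hy⟩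

theorem mem_pre_some {t : N.CleanT M} {p : N.CleanP M} :
    p ∈ (N.cleanShortCirc C M).pre (some t) ↔ p.1 ∈ N.pre t.1 := Iff.rfl

theorem mem_pre_none {p : N.CleanP M} :
    p ∈ (N.cleanShortCirc C M).pre none ↔ p.1 ∈ Pl C := Iff.rfl

theorem mem_places_hatCluster {p : N.CleanP M} : p ∈ Pl (N.hatCluster M C) ↔ p.1 ∈ Pl C := by
  simp [Pl, hatCluster, cleanNodes]

theorem some_mem_hatCluster {t : N.CleanT M} :
    Sum.inr (some t) ∈ N.hatCluster M C ↔ Sum.inr t.1 ∈ C := by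
  simp [hatCluster, cleanNodes]

theorem pre_none : (N.cleanShortCirc C M).pre none = Pl (N.hatCluster M C) :=
  Set.ext fun _ => mem_places_hatCluster.symm

theorem post_none :
    (N.cleanShortCirc C M).post none = {p | 1 ≤ N.cleanMarking M p} := rfl

theorem isProper_cleanShortCirc (hproper : N.IsProper) (hC : N.IsCluster C)
    (hconn : C ⊆ N.conn M) : (N.cleanShortCirc C M).IsProper := by
  rintro (_ | t)
  · obtain ⟨p, hp⟩ := hC.nonempty_places hproper
    obtain ⟨q, hq, -⟩ := hconn hp
    exact ⟨⟨⟨p, hconn hp⟩, hp⟩, ⟨⟨q, q, hq, .refl⟩, hq⟩⟩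
  · obtain ⟨p, hp, hpc⟩ := exists_pre_mem_conn t.2
    obtain ⟨q, hq⟩ := (hproper t.1).2
    exact ⟨⟨⟨p, hpc⟩, hp⟩, ⟨⟨q, conn_flow t.2 hq⟩, hq⟩⟩

theorem cleanShortCirc_pre_eq_or (hfc : N.IsFreeChoice)
    (hC : N.IsCluster C) (t : Option (N.CleanT M)) :
    (N.cleanShortCirc C M).pre t = Pl (N.hatCluster M C) ∨
      (N.cleanShortCirc C M).pre t ∩ Pl (N.hatCluster M C) = ∅ := by
  rcases t with _ | t
  · exact .inl pre_none
  · rw [← pre_none]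
    rcases hC.pre_eq_or hfc t.1 with h | h
    · exact .inl (Set.ext fun p => by rw [mem_pre_some, mem_pre_none, h])
    · refine .inr (Set.eq_empty_of_forall_notMem fun p hp => ?_)
      exact (h ▸ ⟨hp.1, hp.2⟩ : p.1 ∈ (∅ : Set P))

theorem isFreeChoice_cleanShortCirc (hfc : N.IsFreeChoice)
    (hC : N.IsCluster C) : (N.cleanShortCirc C M).IsFreeChoice := by
  have h := cleanShortCirc_pre_eq_or (M := M) hfc hC
  rintro (_ | s) (_ | t)
  · exact .inl rfl
  · rw [pre_none, Set.inter_comm]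
    exact (h (some t)).imp_left Eq.symm
  · rw [pre_none]
    exact h (some s)
  · rcases hfc s.1 t.1 with h | h
    · exact .inl (Set.ext fun p => by rw [mem_pre_some, mem_pre_some, h])
    · refine .inr (Set.eq_empty_of_forall_notMem fun p hp => ?_)
      exact (h ▸ ⟨hp.1, hp.2⟩ : p.1 ∈ (∅ : Set P))

theorem isCluster_hatCluster (hC : N.IsCluster C) :
    (N.cleanShortCirc C M).IsCluster (N.hatCluster M C) := by
  refine ⟨.inr none, Set.Subset.antisymm ?_ ?_⟩
  · have hpl : ∀ p : N.CleanP M, p.1 ∈ Pl C →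
        .inl p ∈ (N.cleanShortCirc C M).cluster (.inr none) := fun p hp =>
      .transition .self (mem_pre_none.2 hp)
    rintro (p | _ | t) h
    · exact hpl p (mem_places_hatCluster.1 h)
    · exact .self
    · obtain ⟨p, hp, hpc⟩ := exists_pre_mem_conn t.2
      have hp' : (⟨p, hpc⟩ : N.CleanP M) ∈ (N.cleanShortCirc C M).pre (some t) := hp
      exact .place (hpl _ (hC.pre_subset (some_mem_hatCluster.1 h) hp)) hp'
  · intro y hy
    induction hy with
    | self => exact .inr rfl
    | @place p t _ hpt ih =>
      rcases t with _ | t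
      · exact .inr rfl
      · exact some_mem_hatCluster.2 (hC.mem_transition (mem_places_hatCluster.1 ih) hpt)
    | @transition p t _ hpt ih =>
      rcases t with _ | t
      · exact mem_places_hatCluster.2 hpt
      · exact mem_places_hatCluster.2 (hC.pre_subset (some_mem_hatCluster.1 ih) hpt)

/-- Every node of the cleaned net can be reached from a marked place in the cleaned net. -/
theorem mem_conn_cleanShortCirc {x : P ⊕ T} (hx : x ∈ N.conn M) :
    ∀ y : N.CleanP M ⊕ N.CleanT M, Sum.map Subtype.val Subtype.val y = x →
      Sum.map id some y ∈ (N.cleanShortCirc C M).conn (N.cleanMarking M) := by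
  obtain ⟨p, hp, hpx⟩ := hx
  induction hpx with
  | refl =>
    rintro (⟨q, hq⟩ | t) h
    · obtain rfl : q = p := Sum.inl.inj h
      exact ⟨⟨q, hq⟩, hp, .refl⟩
    · cases h
  | @tail a b hpa hab ih =>
    match a, b, hpa, hab, ih with
    | .inl q, .inr s, hpa, hqs, ih =>
      rintro (r | t) h
      · cases h
      · obtain rfl : t.1 = s := Sum.inr.inj h
        exact conn_flow (ih (.inl ⟨q, p, hp, hpa⟩) rfl) (y := .inr (some t)) hqs
    | .inr s, .inl q, hpa, hsq, ih =>
      rintro (r | t) h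
      · obtain rfl : r.1 = q := Sum.inl.inj h
        exact conn_flow (ih (.inr ⟨s, p, hp, hpa⟩) rfl) (y := .inl r) hsq
      · cases h

theorem enabled_none {L : Marking (N.CleanP M)} :
    (N.cleanShortCirc C M).Enabled L none ↔ Mrk (N.hatCluster M C) ≤ L := by
  rw [enabled_iff, pre_none, Mrk]

theorem fire_none (hsafe : ∀ p, M p ≤ 1) (X : Marking (N.CleanP M)) :
    (N.cleanShortCirc C M).fire (Mrk (N.hatCluster M C) + X) none = N.cleanMarking M + X := by
  rw [fire_add (enabled_none.2 le_rfl)]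
  congr 1
  funext p
  rw [fire_apply, pre_none, post_none, ofSet_one_le (M := N.cleanMarking M) fun q => hsafe q.1,
    Mrk]
  omega

theorem fire_none' (hsafe : ∀ p, M p ≤ 1) :
    (N.cleanShortCirc C M).fire (Mrk (N.hatCluster M C)) none = N.cleanMarking M := by
  simpa using fire_none (C := C) hsafe 0

/-- A home cluster makes the short-circuited net live and bounded. -/
theorem IsHomeCluster.live_bounded (hproper : N.IsProper) (hfc : N.IsFreeChoice)
    (hsafe : ∀ p, M p ≤ 1) (hC : N.IsCluster C) (hconn : C ⊆ N.conn M)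
    (h : (N.cleanShortCirc C M).IsHomeCluster (N.cleanMarking M) (N.hatCluster M C)) :
    (N.cleanShortCirc C M).IsLive (N.cleanMarking M) ∧
      (N.cleanShortCirc C M).IsBounded (N.cleanMarking M) := by
  have hproper' := isProper_cleanShortCirc hproper hC hconn
  have hfc' := isFreeChoice_cleanShortCirc (M := M) hfc hC
  have hS' := cleanShortCirc_pre_eq_or (M := M) hfc hC
  refine ⟨fun L hL t => ?_, 1, fun L hL p => h.2.le_one hproper' hfc' hS' hL p⟩
  have hmrk := h.2 L hL
  rcases t with _ | t
  · exact ⟨_, hmrk, enabled_none.2 le_rfl⟩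
  · have hM : N.cleanMarking M ∈ (N.cleanShortCirc C M).reach L := by
      refine reach_trans hmrk ?_
      nth_rewrite 1 [← fire_none' (C := C) hsafe]
      exact fire_mem_reach (enabled_none.2 le_rfl)
    obtain ⟨L', hL', ht⟩ := h.2.conn_live hfc' hS' (mem_conn_cleanShortCirc t.2 (.inr t) rfl)
    exact ⟨L', reach_trans hM hL', ht⟩

/-- If the short-circuited net is live and bounded, then it has a home cluster: superfluous tokens
left on enabling the fresh transition could be accumulated. -/
theorem isHomeCluster_of_live_bounded (hsafe : ∀ p, M p ≤ 1) (hC : N.IsCluster C)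
    (hlive : (N.cleanShortCirc C M).IsLive (N.cleanMarking M))
    (hbdd : (N.cleanShortCirc C M).IsBounded (N.cleanMarking M)) :
    (N.cleanShortCirc C M).IsHomeCluster (N.cleanMarking M) (N.hatCluster M C) := by
  refine ⟨isCluster_hatCluster hC, fun L hL => ?_⟩
  obtain ⟨L', hL', hen⟩ := hlive L hL none
  -- `X` is the surplus when `t_C` becomes enabled.
  obtain ⟨X, rfl⟩ := exists_add_of_le (enabled_none.1 hen)
  obtain ⟨σ, hσ⟩ := reach_trans hL hL'
  -- Each round of `σ` followed by `t_C` returns to `M` with one more copy of `X`.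
  have hpump : ∀ n : ℕ, N.cleanMarking M + n • X ∈
      (N.cleanShortCirc C M).reach (N.cleanMarking M) := by
    intro n
    induction n with
    | zero => simpa using mem_reach_self _
    | succ n ih =>
      refine reach_trans ih (reach_trans ⟨σ, hσ.add (n • X)⟩ ?_)
      rw [succ_nsmul', add_assoc, ← fire_none (C := C) hsafe]
      exact fire_mem_reach (enabled_none.2 le_self_add)
  obtain ⟨k, hk⟩ := hbdd
  have hX : X = 0 := by
    by_contra hX
    obtain ⟨p, hp⟩ := exists_one_le_of_ne_zero hX
    have h1 := hk _ (hpump (k + 1)) p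
    simp only [Pi.add_apply, Pi.smul_apply, smul_eq_mul] at h1
    have := Nat.mul_le_mul_left (k + 1) hp
    omega
  rwa [hX, add_zero] at hL'

/-! ### Comparison with the original net -/

theorem one_le_imp_mem_conn (hproper : N.IsProper) {L : Marking P} (hL : L ∈ N.reach M) :
    ∀ p, 1 ≤ L p → Sum.inl p ∈ N.conn M := by
  refine reach_induction (Q := fun L => ∀ p, 1 ≤ L p → Sum.inl p ∈ N.conn M)
    (fun p hp => ⟨p, hp, .refl⟩) (fun L t ih ht p hp => ?_) hL
  by_cases hpt : p ∈ N.post t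
  · obtain ⟨q, hq⟩ := (hproper t).1
    exact conn_flow (conn_flow (ih q (ht q hq)) (y := .inr t) hq) hpt
  · rw [fire_apply, ofSet_apply_of_notMem hpt] at hp
    exact ih p (by omega)

theorem mem_conn_of_enabled (hproper : N.IsProper) {L : Marking P} (hL : L ∈ N.reach M) {t : T}
    (ht : N.Enabled L t) : Sum.inr t ∈ N.conn M := by
  obtain ⟨q, hq⟩ := (hproper t).1
  exact conn_flow (one_le_imp_mem_conn hproper hL q (ht q hq)) hq

/-- When a transition of `conn` becomes enabled, all its inputs carry tokens, and tokens occur only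
on places of `conn`. -/
theorem IsHomeCluster.connInputClosed (hproper : N.IsProper) (hfc : N.IsFreeChoice)
    (h : N.IsHomeCluster M C) : N.ConnInputClosed M := by
  intro t ht p hp
  obtain ⟨L, hL, hen⟩ := h.2.conn_live hfc (h.1.pre_eq_or hfc) ht
  exact one_le_imp_mem_conn hproper hL p (hen p hp)

/-- The restriction of a marking to the places of the cleaned net. -/
def restrictClean (N : Net P T) (M L : Marking P) : Marking (N.CleanP M) := fun p => L p.1

theorem restrictClean_fire (t : N.CleanT M) (L : Marking P) :
    N.restrictClean M (N.fire L t.1) =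
      (N.cleanShortCirc C M).fire (N.restrictClean M L) (some t) := rfl

theorem restrictClean_mrk : N.restrictClean M (Mrk C) = Mrk (N.hatCluster M C) := by
  rw [Mrk, Mrk, ← pre_none]; rfl

theorem mrk_le_of_restrictClean (hconn : C ⊆ N.conn M) {L : Marking P}
    (h : Mrk (N.hatCluster M C) ≤ N.restrictClean M L) : Mrk C ≤ L :=
  ofSet_le.2 fun p hp => ofSet_le.1 h ⟨p, hconn hp⟩ (mem_places_hatCluster.2 hp)

/-- Reachable markings vanish outside `conn`, so restriction loses no tokens. -/
theorem eq_mrk_of_restrictClean (hproper : N.IsProper) {L : Marking P} (hL : L ∈ N.reach M)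
    (hconn : C ⊆ N.conn M) (h : N.restrictClean M L = Mrk (N.hatCluster M C)) : L = Mrk C := by
  refine le_antisymm (fun p => ?_) (mrk_le_of_restrictClean hconn h.ge)
  by_cases hp : 1 ≤ L p
  · have := congrFun (h.trans restrictClean_mrk.symm) ⟨p, one_le_imp_mem_conn hproper hL p hp⟩
    exact this.le
  · exact (Nat.lt_one_iff.1 (not_le.1 hp)).le.trans (Nat.zero_le _)

/-- This direction does not need (K): dropping input places only makes enabling easier. -/
theorem restrictClean_mem_reach (hproper : N.IsProper) {L L' : Marking P} (hL : L ∈ N.reach M)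
    (hL' : L' ∈ N.reach L) :
    N.restrictClean M L' ∈ (N.cleanShortCirc C M).reach (N.restrictClean M L) := by
  refine (reach_induction (Q := fun X => X ∈ N.reach M ∧
    N.restrictClean M X ∈ (N.cleanShortCirc C M).reach (N.restrictClean M L))
    ⟨hL, mem_reach_self _⟩ (fun X t ih ht => ⟨reach_trans ih.1 (fire_mem_reach ht), ?_⟩) hL').2
  have htc := mem_conn_of_enabled hproper ih.1 ht
  refine reach_trans ih.2 ?_
  rw [restrictClean_fire (C := C) ⟨t, htc⟩]
  exact fire_mem_reach fun p hp => ht p.1 hp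

/-- This is where (K) enters: no input place of `t` is invisible in the cleaned net. -/
theorem ConnInputClosed.enabled (hK : N.ConnInputClosed M) {L : Marking P} {t : N.CleanT M}
    (ht : (N.cleanShortCirc C M).Enabled (N.restrictClean M L) (some t)) : N.Enabled L t.1 :=
  fun p hp => ht ⟨p, hK t.1 t.2 p hp⟩ hp

theorem IsHomeCluster.hatCluster (hproper : N.IsProper) (hfc : N.IsFreeChoice)
    (hsafe : ∀ p, M p ≤ 1) (hconn : C ⊆ N.conn M) (hK : N.ConnInputClosed M)
    (h : N.IsHomeCluster M C) :
    (N.cleanShortCirc C M).IsHomeCluster (N.cleanMarking M) (N.hatCluster M C) := by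
  refine ⟨isCluster_hatCluster h.1, fun L' hL' => ?_⟩
  -- Every marking reachable in the short-circuited net is the restriction of one reachable in `N`:
  -- by `eq_of_le`, `t_C` fires only without surplus, and its firing leads back to `M`.
  obtain ⟨L, hL, rfl⟩ := reach_induction (Q := fun L' => ∃ L ∈ N.reach M, N.restrictClean M L = L')
    ⟨M, mem_reach_self M, rfl⟩ (by
      rintro _ (_ | t) ⟨L, hL, rfl⟩ ht
      · have hle := mrk_le_of_restrictClean hconn (enabled_none.1 ht)
        obtain rfl := h.2.eq_of_le hproper hfc (h.1.pre_eq_or hfc) hL hle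
        refine ⟨M, mem_reach_self M, ?_⟩
        change _ = (N.cleanShortCirc C M).fire (N.restrictClean M (Mrk C)) none
        rw [restrictClean_mrk, fire_none' hsafe]
        rfl
      · exact ⟨N.fire L t.1, reach_trans hL (fire_mem_reach (hK.enabled ht)), rfl⟩) hL'
  rw [← restrictClean_mrk]
  exact restrictClean_mem_reach hproper hL (h.2 L hL)

theorem IsHomeCluster.of_hatCluster (hproper : N.IsProper) (hfc : N.IsFreeChoice)
    (hC : N.IsCluster C) (hconn : C ⊆ N.conn M) (hK : N.ConnInputClosed M)
    (h : (N.cleanShortCirc C M).IsHomeCluster (N.cleanMarking M) (N.hatCluster M C)) :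
    N.IsHomeCluster M C := by
  have hproper' := isProper_cleanShortCirc hproper hC hconn
  have hfc' := isFreeChoice_cleanShortCirc (M := M) hfc hC
  have hS' := cleanShortCirc_pre_eq_or (M := M) hfc hC
  refine ⟨hC, fun L hL => ?_⟩
  have hreach {L : Marking P} (hL : L ∈ N.reach M) :
      N.restrictClean M L ∈ (N.cleanShortCirc C M).reach (N.cleanMarking M) :=
    restrictClean_mem_reach hproper (mem_reach_self M) hL
  obtain ⟨σ, hσ⟩ := h.2 _ (hreach hL)
  -- The run is replayed in `N` up to the first `t_C`; if that occurs, the marking before it is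
  -- already the home marking by `eq_of_le`.
  induction σ generalizing L with
  | nil =>
    have : N.restrictClean M L = Mrk (N.hatCluster M C) := by
      generalize Mrk (N.hatCluster M C) = E at hσ
      cases hσ
      rfl
    exact eq_mrk_of_restrictClean hproper hL hconn this ▸ mem_reach_self L
  | cons t σ ih =>
    cases hσ with
    | cons ht hσ =>
      rcases t with _ | t
      · have := h.2.eq_of_le hproper' hfc' hS' (hreach hL) (enabled_none.1 ht)
        exact eq_mrk_of_restrictClean hproper hL hconn this ▸ mem_reach_self L
      · have hen := hK.enabled ht
        exact reach_trans (fire_mem_reach hen)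
          (ih _ (reach_trans hL (fire_mem_reach hen)) hσ)

end Net

/-! ### Assembly of the equivalences -/

theorem theorem3 {P T : Type*} (N : Net P T) (M : Marking P) (C : Set (P ⊕ T))
    (hN : N.IsPetriNet) (hproper : N.IsProper) (hfc : N.IsFreeChoice)
    (hsafe : ∀ p : P, M p ≤ 1)
    (hC : N.IsCluster C) (hconn : C ⊆ N.conn M) :
    (N.ConnInputClosed M →
      List.TFAE [
        N.IsHomeCluster M C,
        (N.cleanShortCirc C M).IsHomeCluster (N.cleanMarking M) (N.hatCluster M C),
        (N.cleanShortCirc C M).IsLive (N.cleanMarking M) ∧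
          (N.cleanShortCirc C M).IsBounded (N.cleanMarking M)]) ∧
    (N.IsHomeCluster M C → N.ConnInputClosed M) ∧
    ((N.cleanShortCirc C M).IsHomeCluster (N.cleanMarking M) (N.hatCluster M C) ↔
      ((N.cleanShortCirc C M).IsLive (N.cleanMarking M) ∧
        (N.cleanShortCirc C M).IsBounded (N.cleanMarking M))) := by
  have h23 : (N.cleanShortCirc C M).IsHomeCluster (N.cleanMarking M) (N.hatCluster M C) ↔
      ((N.cleanShortCirc C M).IsLive (N.cleanMarking M) ∧
        (N.cleanShortCirc C M).IsBounded (N.cleanMarking M)) :=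
    ⟨fun h => h.live_bounded hproper hfc hsafe hC hconn,
      fun h => Net.isHomeCluster_of_live_bounded hsafe hC h.1 h.2⟩
  refine ⟨fun hK => ?_, fun h => h.connInputClosed hproper hfc, h23⟩
  tfae_have 1 → 2 := fun h => h.hatCluster hproper hfc hsafe hconn hK
  tfae_have 2 → 1 := fun h => .of_hatCluster hproper hfc hC hconn hK h
  tfae_have 2 ↔ 3 := h23
  tfae_finish
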